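/- Let $p$ be a prime, let $K=\mathbb{Q}_p(\zeta_p)$ with $\zeta_p$ a primitive $p$-th root of unity, equipped with the unique norm extending the $p$-adic one, and let $\mathfrak{m}_K$ be the maximal ideal of its ring of integers $\mathcal{O}_K$. Then the series $\log_p(1+x)=x-\frac{x^2}{2}+\frac{x^3}{3}-\cdots$ converges in $K$ for every $x\in\mathfrak{m}_K$, and the image $\log_p(1+\mathfrak{m}_K)$ equals $\mathfrak{m}_K^2$. This image is a pro-$p$ group (in the topology of $K$), and it is a subgroup of index $p$ in the additive group $\mathfrak{m}_K$: $$[\mathfrak{m}_K:\log_p(1+\mathfrak{m}_K)]=p.$$ -/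

import Mathlib

/-- The ring of integers of a normed field extension `K` of `ℚ_[p]` (whose norm is automatically
ultrametric and extends the `p`-adic one): the valuation ring of the norm, that is, the closed
unit ball. -/
noncomputable def ringOfIntegers (p : ℕ) [Fact p.Prime] (K : Type*) [NormedField K]
    [NormedAlgebra ℚ_[p] K] : ValuationSubring K :=
  haveI : IsUltrametricDist K := IsUltrametricDist.of_normedAlgebra ℚ_[p]
  (NormedField.valuation (K := K)).valuationSubring

theorem mem_ringOfIntegers (p : ℕ) [Fact p.Prime] (K : Type*) [NormedField K]
    [NormedAlgebra ℚ_[p] K] (x : K) : x ∈ ringOfIntegers p K ↔ ‖x‖ ≤ 1 := by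
  haveI : IsUltrametricDist K := IsUltrametricDist.of_normedAlgebra ℚ_[p]
  exact Iff.rfl

/-- The maximal ideal `𝔪_K` of the ring of integers. -/
noncomputable abbrev maxIdeal (p : ℕ) [Fact p.Prime] (K : Type*) [NormedField K]
    [NormedAlgebra ℚ_[p] K] : Ideal (ringOfIntegers p K) :=
  IsLocalRing.maximalIdeal (ringOfIntegers p K)

/-- The group of principal units `1 + 𝔪_K`, as a subset of `K`. -/
def principalUnits (p : ℕ) [Fact p.Prime] (K : Type*) [NormedField K]
    [NormedAlgebra ℚ_[p] K] : Set K :=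
  {u | ∃ x ∈ maxIdeal p K, u = 1 + (x : K)}

/-- The `n`-th term (counted from `n = 0`) of the series `x - x²/2 + x³/3 - ⋯`. -/
noncomputable def logTerm {K : Type*} [NormedField K] (x : K) (n : ℕ) : K :=
  (-1) ^ n * x ^ (n + 1) / ((n + 1 : ℕ) : K)

/-- The `p`-adic logarithm `log_p (1 + x) = x - x²/2 + x³/3 - ⋯`, as a function of `u = 1 + x`,
the sum being taken in the topology of `K`. -/
noncomputable def padicLog {K : Type*} [NormedField K] (u : K) : K :=
  ∑' n : ℕ, logTerm (u - 1) n

/-- A topological (additive) group is pro-`p` if it is profinite and each open normal subgroup has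
index a power of `p`. -/
structure IsProPAddGroup (p : ℕ) (G : Type*) [AddGroup G] [TopologicalSpace G] : Prop where
  isTopologicalAddGroup : IsTopologicalAddGroup G
  compactSpace : CompactSpace G
  t2Space : T2Space G
  totallyDisconnectedSpace : TotallyDisconnectedSpace G
  index_eq_pow : ∀ U : AddSubgroup G, U.Normal → IsOpen (U : Set G) → ∃ k : ℕ, U.index = p ^ k

/-! ### The uniformizer `ζ - 1` and the residue field. -/

section Uniformizer

variable {p : ℕ} [hp : Fact p.Prime] {K : Type*} [NormedField K] [NormedAlgebra ℚ_[p] K]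

/-! Put π = ζ - 1. Expanding (π + 1)^p = 1 gives π^(p-1)/p ≡ -1 mod π, so |π|^(p-1) = 1/p.
Expansions in powers of π then show that π is a uniformizer and that the residue field is 𝔽_p.

The image lies in 𝔪²: every term of the series except x and ±x^p/p has norm at most |π|²
(`norm_logTerm_le`). With x = πa those two add up to π(a - a^p) mod π², and a^p ≡ a in 𝔽_p
(`norm_add_logTerm_le`).

The image is all of 𝔪²: on the ball |x| ≤ |π|² the map log(1+x) - x is a strict contraction, so
log(1+x) = z is solved by a fixed point (`exists_padicLog_eq`).

The index is the order of 𝔪/𝔪², a line over 𝔽_p. As a closed ball in a locally compact field, 𝔪² is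
compact, and p^n g → 0 makes its finite quotients by open subgroups p-groups. -/

theorem norm_natCast_eq_padic (n : ℕ) : ‖(n : K)‖ = ‖(n : ℚ_[p])‖ := by
  rw [← norm_algebraMap' K (n : ℚ_[p]), map_natCast]

theorem norm_natCast_eq_pow (n : ℕ) (hn : n ≠ 0) :
    ‖(n : K)‖ = ((p : ℝ)⁻¹) ^ padicValNat p n := by
  rw [norm_natCast_eq_padic (p := p),
    Padic.norm_eq_zpow_neg_valuation (by exact_mod_cast hn), Padic.valuation_natCast,
    zpow_neg, zpow_natCast, inv_pow]

theorem norm_prime_eq : ‖(p : K)‖ = (p : ℝ)⁻¹ := by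
  rw [norm_natCast_eq_padic (p := p), Padic.norm_p]

theorem prime_inv_lt_one : (p : ℝ)⁻¹ < 1 :=
  inv_lt_one_of_one_lt₀ (by exact_mod_cast hp.out.one_lt)

/-- The Eisenstein relation for `ζ - 1`, in terms of the norm. -/
theorem norm_sub_one_pow_add_prime_le {ζ : K} (hζ : IsPrimitiveRoot ζ p) :
    ‖ζ - 1‖ < 1 ∧ ‖(ζ - 1) ^ (p - 1) + p‖ ≤ (p : ℝ)⁻¹ * ‖ζ - 1‖ := by
  have : IsUltrametricDist K := IsUltrametricDist.of_normedAlgebra ℚ_[p]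
  have hp1 := hp.out.one_lt
  set π := ζ - 1 with hπ
  have hζ1 : ‖ζ‖ = 1 := by
    rw [← pow_eq_one_iff_of_nonneg (norm_nonneg ζ) hp.out.ne_zero, ← norm_pow, hζ.pow_eq_one,
      norm_one]
  have hπ1 : ‖π‖ ≤ 1 := by
    rw [hπ, sub_eq_add_neg]
    exact (IsUltrametricDist.norm_add_le_max _ _).trans (by simp [hζ1])
  have hπ0 : π ≠ 0 := sub_ne_zero.mpr (hζ.ne_one hp1)
  have key := add_pow_prime_eq hp.out π 1
  rw [show π + 1 = ζ by rw [hπ]; ring, hζ.pow_eq_one] at key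
  simp only [one_pow, mul_one] at key
  set S := ∑ k ∈ Finset.Ioo 0 p, π ^ (k - 1) * ((p.choose k / p : ℕ) : K) with hS
  have hpow : π ^ (p - 1) = -(p * S) := by
    apply mul_left_cancel₀ hπ0
    rw [← pow_succ', Nat.sub_add_cancel hp1.le]
    linear_combination -key
  have hS1 : ‖S‖ ≤ 1 := by
    refine IsUltrametricDist.norm_sum_le_of_forall_le_of_nonneg zero_le_one fun k _ => ?_
    rw [norm_mul, norm_pow]
    exact mul_le_one₀ (pow_le_one₀ (norm_nonneg _) hπ1) (norm_nonneg _)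
      (IsUltrametricDist.norm_natCast_le_one K _)
  have hlt : ‖π‖ < 1 := by
    have : ‖π‖ ^ (p - 1) < 1 := by
      rw [← norm_pow, hpow, norm_neg, norm_mul, norm_prime_eq (p := p)]
      exact (mul_le_of_le_one_right (by positivity) hS1).trans_lt prime_inv_lt_one
    by_contra h
    exact absurd this (not_lt.2 (one_le_pow₀ (not_lt.1 h)))
  refine ⟨hlt, ?_⟩
  -- The k = 1 term of S is 1, and all the others carry a factor π.
  have hS2 : ‖1 - S‖ ≤ ‖π‖ := by
    have hmem : 1 ∈ Finset.Ioo 0 p := by simp [hp1]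
    rw [hS, ← Finset.add_sum_erase _ _ hmem]
    simp only [Nat.sub_self, pow_zero, Nat.choose_one_right, Nat.div_self hp.out.pos,
      Nat.cast_one, mul_one, sub_add_cancel_left, norm_neg]
    refine IsUltrametricDist.norm_sum_le_of_forall_le_of_nonneg (norm_nonneg _) fun k hk => ?_
    simp only [Finset.mem_erase, Finset.mem_Ioo] at hk
    rw [norm_mul, norm_pow]
    refine (mul_le_of_le_one_right (by positivity)
      (IsUltrametricDist.norm_natCast_le_one K _)).trans ?_
    exact pow_le_of_le_one (norm_nonneg _) hπ1 (by omega)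
  rw [hpow, show -((p : K) * S) + p = p * (1 - S) by ring, norm_mul, norm_prime_eq (p := p)]
  gcongr

theorem norm_sub_one_pow {ζ : K} (hζ : IsPrimitiveRoot ζ p) :
    ‖ζ - 1‖ ^ (p - 1) = (p : ℝ)⁻¹ := by
  have : IsUltrametricDist K := IsUltrametricDist.of_normedAlgebra ℚ_[p]
  obtain ⟨h1, h2⟩ := norm_sub_one_pow_add_prime_le (p := p) hζ
  have hpos : (0 : ℝ) < (p : ℝ)⁻¹ := inv_pos.2 (by exact_mod_cast hp.out.pos)
  have h3 : ‖(ζ - 1) ^ (p - 1) + p‖ < ‖-(p : K)‖ := by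
    rw [norm_neg, norm_prime_eq (p := p)]
    exact h2.trans_lt (mul_lt_of_lt_one_right hpos h1)
  have h4 := IsUltrametricDist.norm_add_eq_max_of_norm_ne_norm h3.ne
  rw [add_neg_cancel_right, max_eq_right h3.le, norm_pow, norm_neg, norm_prime_eq (p := p)] at h4
  exact h4

/-- Raising to the power p - 1 turns both sides into integral powers of p, whose exponents give i ≡
j mod p - 1. -/
theorem eq_of_norm_mul_pow_eq {r : ℝ} (hr : r ^ (p - 1) = (p : ℝ)⁻¹) {a b : ℚ_[p]} (ha : a ≠ 0)
    (hb : b ≠ 0) {i j : ℕ} (hi : i < p - 1) (hj : j < p - 1) (h : ‖a‖ * r ^ i = ‖b‖ * r ^ j) :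
    i = j := by
  have hp0 : (p : ℝ) ≠ 0 := by exact_mod_cast hp.out.ne_zero
  have hp1 : (1 : ℝ) < p := by exact_mod_cast hp.out.one_lt
  have h' := congrArg (· ^ (p - 1)) h
  simp only [mul_pow, ← pow_mul, mul_comm _ (p - 1)] at h'
  rw [pow_mul, pow_mul, hr, Padic.norm_eq_zpow_neg_valuation ha,
    Padic.norm_eq_zpow_neg_valuation hb, ← zpow_natCast, ← zpow_natCast, ← zpow_natCast,
    ← zpow_natCast, ← zpow_mul, ← zpow_mul, inv_zpow', inv_zpow', ← zpow_add₀ hp0,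
    ← zpow_add₀ hp0] at h'
  have h2 := zpow_right_injective₀ (by linarith) hp1.ne' h'
  have h3 : ((p - 1 : ℕ) : ℤ) ∣ (j : ℤ) - i :=
    ⟨a.valuation - b.valuation, by linear_combination h2⟩
  have h4 := Int.eq_zero_of_abs_lt_dvd h3 (by rw [abs_lt]; omega)
  omega

theorem natDegree_minpoly_le {ζ : K} (hζ : IsPrimitiveRoot ζ p) :
    (minpoly ℚ_[p] ζ).natDegree ≤ p - 1 := by
  rw [← Nat.totient_prime hp.out, ← Polynomial.natDegree_cyclotomic p ℚ_[p]]
  refine Polynomial.natDegree_le_of_dvd (minpoly.dvd _ _ ?_) (Polynomial.cyclotomic_ne_zero _ _)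
  have : NeZero (p : K) :=
    ⟨by rw [← norm_ne_zero_iff, norm_prime_eq (p := p)]
        exact inv_ne_zero (by exact_mod_cast hp.out.ne_zero)⟩
  rw [Polynomial.aeval_def, Polynomial.eval₂_eq_eval_map, Polynomial.map_cyclotomic]
  exact (Polynomial.isRoot_cyclotomic_iff).2 hζ

/-- The nonzero terms of the expansion have pairwise distinct norms, so the ultrametric norm of the
sum is their maximum. Only the bound d ≤ p - 1 is needed, not irreducibility of the cyclotomic
polynomial. -/
theorem exists_norm_eq_sup_coeff [IsCyclotomicExtension {p} ℚ_[p] K] {ζ : K}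
    (hζ : IsPrimitiveRoot ζ p) (x : K) :
    ∃ (d : ℕ) (c : Fin d → ℚ_[p]), d ≤ p - 1 ∧
      x = ∑ i, algebraMap ℚ_[p] K (c i) * (ζ - 1) ^ (i : ℕ) ∧
      ∀ i, ‖c i‖ * ‖ζ - 1‖ ^ (i : ℕ) ≤ ‖x‖ := by
  have : IsUltrametricDist K := IsUltrametricDist.of_normedAlgebra ℚ_[p]
  classical
  have hr := norm_sub_one_pow (p := p) hζ
  set B := hζ.subOnePowerBasis ℚ_[p]
  have hgen : B.gen = ζ - 1 := hζ.subOnePowerBasis_gen ℚ_[p]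
  have hdim : B.dim ≤ p - 1 := by
    rw [← B.finrank, (hζ.powerBasis ℚ_[p]).finrank, IsPrimitiveRoot.powerBasis_dim]
    exact natDegree_minpoly_le hζ
  set c := fun i => B.basis.repr x i with hc
  have hx : x = ∑ i, algebraMap ℚ_[p] K (c i) * (ζ - 1) ^ (i : ℕ) := by
    conv_lhs => rw [← B.basis.sum_repr x]
    simp [hc, hgen, Algebra.smul_def]
  refine ⟨B.dim, c, hdim, hx, fun i => ?_⟩
  set f : Fin B.dim → K := fun i => algebraMap ℚ_[p] K (c i) * (ζ - 1) ^ (i : ℕ) with hf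
  have hnf : ∀ i, ‖f i‖ = ‖c i‖ * ‖ζ - 1‖ ^ (i : ℕ) := fun i => by
    change ‖algebraMap ℚ_[p] K (c i) * (ζ - 1) ^ (i : ℕ)‖ = _
    rw [norm_mul, norm_pow, norm_algebraMap']
  rw [← hnf]
  by_cases hi : c i = 0
  · rw [hnf, hi, norm_zero, zero_mul]
    exact norm_nonneg x
  have hsum : x = ∑ j ∈ Finset.univ.filter (fun j => c j ≠ 0), f j := by
    rw [hx, Finset.sum_filter_of_ne]
    intro j _ hj h0
    exact hj (by rw [← norm_eq_zero, hnf, h0, norm_zero, zero_mul])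
  have hmem : i ∈ Finset.univ.filter (fun j => c j ≠ 0) := by simp [hi]
  rw [hsum, IsUltrametricDist.norm_sum_eq_sup'_of_pairwise_ne ⟨i, hmem⟩]
  · exact Finset.le_sup' (fun i => ‖f i‖) hmem
  · intro j hj k hk hjk h
    simp only [Finset.coe_filter, Finset.mem_univ, true_and, Set.mem_ofPred_eq] at hj hk
    simp only [hnf] at h
    exact hjk (Fin.ext (eq_of_norm_mul_pow_eq hr hj hk (j.2.trans_le hdim) (k.2.trans_le hdim) h))

theorem exists_padic_norm_sub_le [IsCyclotomicExtension {p} ℚ_[p] K] {ζ : K}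
    (hζ : IsPrimitiveRoot ζ p) {x : K} (hx : ‖x‖ ≤ 1) :
    ∃ a : ℚ_[p], ‖a‖ ≤ ‖x‖ ∧ ‖x - algebraMap ℚ_[p] K a‖ ≤ ‖ζ - 1‖ := by
  have : IsUltrametricDist K := IsUltrametricDist.of_normedAlgebra ℚ_[p]
  have hr := norm_sub_one_pow (p := p) hζ
  have hlt := (norm_sub_one_pow_add_prime_le (p := p) hζ).1
  have hp0 : (0 : ℝ) < p := by exact_mod_cast hp.out.pos
  have hr0 : 0 < ‖ζ - 1‖ := norm_pos_iff.2 (sub_ne_zero.mpr (hζ.ne_one hp.out.one_lt))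
  obtain ⟨d, c, hd, hxc, hle⟩ := exists_norm_eq_sup_coeff hζ x
  have hc : ∀ i, ‖c i‖ ≤ 1 := fun i => by
    -- Norms on ℚ_p are powers of p, so a bound strictly below p already gives at most 1.
    have h1 : ‖c i‖ < p := by
      by_contra! h
      have h2 : (1 : ℝ) < ‖c i‖ * ‖ζ - 1‖ ^ (i : ℕ) := by
        calc (1 : ℝ) = p * ‖ζ - 1‖ ^ (p - 1) := by rw [hr]; field_simp
          _ < p * ‖ζ - 1‖ ^ (i : ℕ) := by
            have := pow_lt_pow_right_of_lt_one₀ hr0 hlt (i.2.trans_le hd)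
            gcongr
          _ ≤ _ := by gcongr
      exact absurd h2 (not_lt.2 ((hle i).trans hx))
    have := (Padic.norm_le_pow_iff_norm_lt_pow_add_one (c i) 0).2 (by simpa using h1)
    simpa using this
  rcases d with _ | d
  · refine ⟨0, by simp, ?_⟩
    rw [hxc]; simp
  · refine ⟨c 0, by simpa using hle 0, ?_⟩
    rw [hxc, Fin.sum_univ_succ]
    simp only [Fin.val_zero, pow_zero, mul_one, add_sub_cancel_left]
    refine IsUltrametricDist.norm_sum_le_of_forall_le_of_nonneg hr0.le fun i _ => ?_
    rw [norm_mul, norm_pow, norm_algebraMap']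
    calc _ ≤ 1 * ‖ζ - 1‖ ^ (i.succ : ℕ) := by gcongr; exact hc _
      _ ≤ _ := by
        rw [one_mul]
        exact pow_le_of_le_one hr0.le hlt.le (by simp)

theorem norm_le_of_norm_lt_one [IsCyclotomicExtension {p} ℚ_[p] K] {ζ : K}
    (hζ : IsPrimitiveRoot ζ p) {x : K} (hx : ‖x‖ < 1) : ‖x‖ ≤ ‖ζ - 1‖ := by
  have : IsUltrametricDist K := IsUltrametricDist.of_normedAlgebra ℚ_[p]
  have hlt := (norm_sub_one_pow_add_prime_le (p := p) hζ).1
  obtain ⟨a, ha, hxa⟩ := exists_padic_norm_sub_le hζ hx.le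
  have h1 : ‖a‖ ≤ ‖ζ - 1‖ := by
    have := (Padic.norm_le_pow_iff_norm_lt_pow_add_one a (-1)).2 (by simpa using ha.trans_lt hx)
    rw [zpow_neg_one, ← norm_sub_one_pow (p := p) hζ] at this
    exact this.trans (pow_le_of_le_one (norm_nonneg _) hlt.le
      (by have := hp.out.two_le; omega))
  rw [← sub_add_cancel x (algebraMap ℚ_[p] K a)]
  exact (IsUltrametricDist.norm_add_le_max _ _).trans (max_le hxa (by rwa [norm_algebraMap']))

/-- The residue field is 𝔽_p: modulo π only the constant coefficient survives, and it reduces to a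
digit. -/
theorem exists_natCast_norm_sub_le [IsCyclotomicExtension {p} ℚ_[p] K] {ζ : K}
    (hζ : IsPrimitiveRoot ζ p) {x : K} (hx : ‖x‖ ≤ 1) : ∃ n < p, ‖x - (n : K)‖ ≤ ‖ζ - 1‖ := by
  have : IsUltrametricDist K := IsUltrametricDist.of_normedAlgebra ℚ_[p]
  have hlt := (norm_sub_one_pow_add_prime_le (p := p) hζ).1
  obtain ⟨a, ha, hxa⟩ := exists_padic_norm_sub_le hζ hx
  set b : ℤ_[p] := ⟨a, ha.trans hx⟩ with hb
  refine ⟨b.zmodRepr, b.zmodRepr_lt_p, norm_le_of_norm_lt_one hζ ?_⟩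
  have h1 : ‖algebraMap ℚ_[p] K (a - (b.zmodRepr : ℚ_[p]))‖ < 1 := by
    rw [norm_algebraMap']
    have := b.norm_sub_zmodRepr_lt_one
    rwa [PadicInt.norm_def, PadicInt.coe_sub, PadicInt.coe_natCast] at this
  rw [map_sub, map_natCast] at h1
  rw [← sub_add_sub_cancel x (algebraMap ℚ_[p] K a)]
  exact (IsUltrametricDist.norm_add_le_max _ _).trans_lt (max_lt (hxa.trans_lt hlt) h1)

end Uniformizer

/-! ### Estimates for the logarithm series. -/

section Logarithm

open Filter Topology

variable {p : ℕ} [hp : Fact p.Prime] {K : Type*} [NormedField K] [NormedAlgebra ℚ_[p] K]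


theorem one_add_mul_padicValNat_le (n : ℕ) :
    1 + padicValNat p (n + 1) * (p - 1) ≤ p ^ padicValNat p (n + 1) := by
  have h := one_add_mul_le_pow (R := ℤ) (a := (p : ℤ) - 1) (by have := hp.out.two_le; omega)
    (padicValNat p (n + 1))
  rw [add_sub_cancel, ← Nat.cast_one, ← Nat.cast_sub hp.out.one_le] at h
  exact_mod_cast h

theorem pow_padicValNat_le (p n : ℕ) : p ^ padicValNat p (n + 1) ≤ n + 1 :=
  Nat.le_of_dvd n.succ_pos pow_padicValNat_dvd

theorem sub_one_mul_padicValNat_le (n : ℕ) : (p - 1) * padicValNat p (n + 1) ≤ n := by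
  have h1 := one_add_mul_padicValNat_le (p := p) n
  have h2 := pow_padicValNat_le p n
  rw [mul_comm] at h1
  omega

/-- Equality would force p^v = 1 + (p-1)v, where v is the valuation of n + 1; this fails for v ≥ 2,
and v = 0, 1 are the excluded cases. -/
theorem sub_one_mul_padicValNat_lt {n : ℕ} (h0 : n ≠ 0) (h1 : n + 1 ≠ p) :
    (p - 1) * padicValNat p (n + 1) < n := by
  have hp2 := hp.out.two_le
  refine lt_of_le_of_ne (sub_one_mul_padicValNat_le n) fun h => ?_
  have h2 := one_add_mul_padicValNat_le (p := p) n
  have h3 := pow_padicValNat_le p n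
  rw [mul_comm] at h2
  have h4 : p ^ padicValNat p (n + 1) = n + 1 := by omega
  replace h4 : p ^ padicValNat p (n + 1) = (p - 1) * padicValNat p (n + 1) + 1 := by
    rw [h, h4]
  have h7 : padicValNat p (n + 1) ≠ 0 := fun h8 => h0 (by rw [← h, h8, mul_zero])
  have h8 : padicValNat p (n + 1) ≠ 1 := fun h8 => h1 (by rw [h8, mul_one] at h; omega)
  clear h2 h3 h h0 h1
  generalize padicValNat p (n + 1) = v at *
  obtain ⟨q, rfl⟩ : ∃ q, p = q + 2 := ⟨p - 2, by omega⟩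
  rw [show q + 2 - 1 = q + 1 by omega] at *
  rcases v with _ | _ | v
  · omega
  · omega
  -- Bernoulli one exponent lower, multiplied by p, is strictly stronger than Bernoulli itself.
  · have hb := one_add_mul_le_pow (R := ℤ) (a := (q : ℤ) + 1) (by omega) (v + 1)
    have h5 : ((q : ℤ) + 2) ^ (v + 2) = (q + 1) * (v + 2) + 1 := by exact_mod_cast h4
    rw [show (1 : ℤ) + (q + 1) = q + 2 by ring] at hb
    push_cast at hb
    have h6 := mul_le_mul_of_nonneg_left hb (show (0 : ℤ) ≤ (q : ℤ) + 2 by omega)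
    rw [← pow_succ', h5] at h6
    have hv : (0 : ℤ) ≤ v := by omega
    have hq : (0 : ℤ) ≤ q := by omega
    nlinarith [mul_nonneg hv hq, mul_nonneg (mul_nonneg hv hq) hq, mul_nonneg hq hq]

theorem norm_succ_eq_pow {ζ : K} (hζ : IsPrimitiveRoot ζ p) (n : ℕ) :
    ‖((n + 1 : ℕ) : K)‖ = ‖ζ - 1‖ ^ ((p - 1) * padicValNat p (n + 1)) := by
  rw [norm_natCast_eq_pow (p := p) _ n.succ_ne_zero, pow_mul, norm_sub_one_pow hζ]

theorem norm_logTerm (x : K) (n : ℕ) :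
    ‖logTerm x n‖ = ‖x‖ ^ (n + 1) / ‖((n + 1 : ℕ) : K)‖ := by
  simp [logTerm]

theorem tendsto_logTerm (p : ℕ) [hp : Fact p.Prime] {K : Type*} [NormedField K] [NormedAlgebra ℚ_[p] K]
    {x : K} (hx : ‖x‖ < 1) :
    Tendsto (logTerm x) atTop (𝓝 0) := by
  have h1 : Tendsto (fun n : ℕ => ((n + 1 : ℕ) : ℝ) * ‖x‖ ^ (n + 1)) atTop (𝓝 0) :=
    (tendsto_self_mul_const_pow_of_lt_one (norm_nonneg x) hx).comp (tendsto_add_atTop_nat 1)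
  refine squeeze_zero_norm (fun n => ?_) h1
  have hp0 : (0 : ℝ) < p := by exact_mod_cast hp.out.pos
  have hv : (p : ℝ) ^ padicValNat p (n + 1) ≤ ((n + 1 : ℕ) : ℝ) := by
    exact_mod_cast pow_padicValNat_le p n
  rw [norm_logTerm, norm_natCast_eq_pow (p := p) _ n.succ_ne_zero, inv_pow, div_inv_eq_mul,
    mul_comm]
  gcongr

theorem summable_logTerm (p : ℕ) [hp : Fact p.Prime] {K : Type*} [NormedField K] [NormedAlgebra ℚ_[p] K]
    [CompleteSpace K] {x : K} (hx : ‖x‖ < 1) : Summable (logTerm x) := by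
  have : IsUltrametricDist K := IsUltrametricDist.of_normedAlgebra ℚ_[p]
  refine NonarchimedeanAddGroup.summable_of_tendsto_cofinite_zero ?_
  rw [Nat.cofinite_eq_atTop]
  exact tendsto_logTerm p hx

theorem norm_logTerm_sub_le {ζ : K} (hζ : IsPrimitiveRoot ζ p) {x y : K}
    (hx : ‖x‖ ≤ ‖ζ - 1‖ ^ 2) (hy : ‖y‖ ≤ ‖ζ - 1‖ ^ 2) {n : ℕ} (hn : n ≠ 0) :
    ‖logTerm x n - logTerm y n‖ ≤ ‖ζ - 1‖ * ‖x - y‖ := by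
  have : IsUltrametricDist K := IsUltrametricDist.of_normedAlgebra ℚ_[p]
  have hlt := (norm_sub_one_pow_add_prime_le (p := p) hζ).1
  have hr0 : 0 < ‖ζ - 1‖ := norm_pos_iff.2 (sub_ne_zero.mpr (hζ.ne_one hp.out.one_lt))
  have h1 : ‖logTerm x n - logTerm y n‖ = ‖x ^ (n + 1) - y ^ (n + 1)‖ /
      ‖ζ - 1‖ ^ ((p - 1) * padicValNat p (n + 1)) := by
    rw [logTerm, logTerm, ← sub_div, ← mul_sub, norm_div, norm_mul, norm_succ_eq_pow hζ]
    simp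
  have h2 : ‖∑ i ∈ Finset.range (n + 1), x ^ i * y ^ (n + 1 - 1 - i)‖ ≤ ‖ζ - 1‖ ^ (2 * n) := by
    refine IsUltrametricDist.norm_sum_le_of_forall_le_of_nonneg (by positivity) fun i hi => ?_
    have hi' := Finset.mem_range.1 hi
    rw [norm_mul, norm_pow, norm_pow]
    calc _ ≤ (‖ζ - 1‖ ^ 2) ^ i * (‖ζ - 1‖ ^ 2) ^ (n + 1 - 1 - i) := by gcongr
      _ = _ := by rw [← pow_add, ← pow_mul]; congr 1; omega
  rw [h1, div_le_iff₀ (by positivity), ← geom_sum₂_mul, norm_mul, mul_right_comm, ← pow_succ']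
  refine mul_le_mul_of_nonneg_right (h2.trans ?_) (norm_nonneg _)
  -- The exponents compare as (p-1)v + 1 ≤ n + 1 ≤ 2n, by n ≥ 1.
  refine pow_le_pow_of_le_one hr0.le hlt.le ?_
  have := sub_one_mul_padicValNat_le (p := p) n
  omega

theorem norm_padicLog_sub_sub_le [CompleteSpace K] {ζ : K} (hζ : IsPrimitiveRoot ζ p) {x y : K}
    (hx : ‖x‖ ≤ ‖ζ - 1‖ ^ 2) (hy : ‖y‖ ≤ ‖ζ - 1‖ ^ 2) :
    ‖(padicLog (1 + x) - padicLog (1 + y)) - (x - y)‖ ≤ ‖ζ - 1‖ * ‖x - y‖ := by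
  have : IsUltrametricDist K := IsUltrametricDist.of_normedAlgebra ℚ_[p]
  have hlt := (norm_sub_one_pow_add_prime_le (p := p) hζ).1
  have hr2 : ‖ζ - 1‖ ^ 2 < 1 := pow_lt_one₀ (norm_nonneg _) hlt two_ne_zero
  have hsx := summable_logTerm p (hx.trans_lt hr2)
  have hsy := summable_logTerm p (hy.trans_lt hr2)
  rw [padicLog, padicLog, add_sub_cancel_left, add_sub_cancel_left, ← hsx.tsum_sub hsy,
    (hsx.sub hsy).tsum_eq_zero_add]
  simp only [logTerm, pow_zero, one_mul, zero_add, pow_one, Nat.cast_one, div_one,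
    add_sub_cancel_left]
  exact IsUltrametricDist.norm_tsum_le_of_forall_le fun n =>
    norm_logTerm_sub_le hζ hx hy n.succ_ne_zero

theorem exists_padicLog_eq [CompleteSpace K] {ζ : K} (hζ : IsPrimitiveRoot ζ p) {z : K}
    (hz : ‖z‖ ≤ ‖ζ - 1‖ ^ 2) : ∃ x : K, ‖x‖ ≤ ‖ζ - 1‖ ^ 2 ∧ padicLog (1 + x) = z := by
  have : IsUltrametricDist K := IsUltrametricDist.of_normedAlgebra ℚ_[p]
  have hlt := (norm_sub_one_pow_add_prime_le (p := p) hζ).1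
  set s : Set K := {x | ‖x‖ ≤ ‖ζ - 1‖ ^ 2} with hs
  -- A fixed point of f is exactly a solution of log(1+x) = z.
  set f : K → K := fun x => x - padicLog (1 + x) + z with hf
  have hfsub : ∀ x ∈ s, ∀ y ∈ s, ‖f x - f y‖ ≤ ‖ζ - 1‖ * ‖x - y‖ := fun x hx y hy => by
    have h : f x - f y = -((padicLog (1 + x) - padicLog (1 + y)) - (x - y)) := by
      simp only [hf]
      ring
    rw [h, norm_neg]
    exact norm_padicLog_sub_sub_le hζ hx hy
  have h0 : (0 : K) ∈ s := by simp [hs]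
  have hf0 : f 0 = z := by simp [hf, padicLog, logTerm]
  have hmaps : Set.MapsTo f s s := fun x hx => by
    have h1 := hfsub x hx 0 h0
    rw [hf0, sub_zero] at h1
    rw [hs, Set.mem_ofPred_eq, ← sub_add_cancel (f x) z]
    refine (IsUltrametricDist.norm_add_le_max _ _).trans (max_le ?_ hz)
    exact h1.trans ((mul_le_of_le_one_left (norm_nonneg _) hlt.le).trans hx)
  have hcomplete : IsComplete s :=
    (isClosed_le continuous_norm continuous_const).isComplete
  have hcontr : ContractingWith ‖ζ - 1‖₊ (hmaps.restrict f s s) := by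
    refine ⟨by exact_mod_cast hlt, LipschitzWith.of_dist_le_mul fun x y => ?_⟩
    simpa [Subtype.dist_eq, dist_eq_norm] using hfsub x x.2 y y.2
  obtain ⟨x, hx, hfx, -⟩ := hcontr.exists_fixedPoint' hcomplete hmaps h0 (edist_ne_top _ _)
  refine ⟨x, hx, ?_⟩
  have : x - padicLog (1 + x) + z = x := hfx
  linear_combination -this

theorem norm_pow_sub_self_le [IsCyclotomicExtension {p} ℚ_[p] K] {ζ : K}
    (hζ : IsPrimitiveRoot ζ p) {a : K} (ha : ‖a‖ ≤ 1) : ‖a ^ p - a‖ ≤ ‖ζ - 1‖ := by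
  have : IsUltrametricDist K := IsUltrametricDist.of_normedAlgebra ℚ_[p]
  obtain ⟨n, -, hn⟩ := exists_natCast_norm_sub_le hζ ha
  have h1 : ‖a ^ p - (n : K) ^ p‖ ≤ ‖ζ - 1‖ := by
    rw [← geom_sum₂_mul, norm_mul]
    refine (mul_le_of_le_one_left (norm_nonneg _) ?_).trans hn
    refine IsUltrametricDist.norm_sum_le_of_forall_le_of_nonneg zero_le_one fun i _ => ?_
    rw [norm_mul, norm_pow, norm_pow]
    exact mul_le_one₀ (pow_le_one₀ (norm_nonneg _) ha) (by positivity)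
      (pow_le_one₀ (norm_nonneg _) (IsUltrametricDist.norm_natCast_le_one K _))
  have h2 : ‖(n : K) ^ p - n‖ ≤ ‖ζ - 1‖ := by
    refine norm_le_of_norm_lt_one hζ ?_
    have h3 : (p : ℤ) ∣ (n : ℤ) ^ p - n := by
      rw [← ZMod.intCast_zmod_eq_zero_iff_dvd]
      simp
    rw [← Padic.norm_intCast_lt_one_iff, ← norm_algebraMap' K] at h3
    simpa using h3
  rw [show a ^ p - a = (a ^ p - (n : K) ^ p) + (((n : K) ^ p - n) + -(a - n)) by ring]
  refine (IsUltrametricDist.norm_add_le_max _ _).trans (max_le h1 ?_)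
  exact (IsUltrametricDist.norm_add_le_max _ _).trans (max_le h2 (by rwa [norm_neg]))

/-- The sign of x^p/p matters only for p = 2, where 1 - (-1) = 2 has norm |π|. -/
theorem norm_one_sub_neg_one_pow_le {ζ : K} (hζ : IsPrimitiveRoot ζ p) :
    ‖1 - (-1 : K) ^ (p - 1)‖ ≤ ‖ζ - 1‖ := by
  rcases hp.out.eq_two_or_odd' with h | h
  · subst h
    have h1 := norm_sub_one_pow hζ
    have h2 := norm_prime_eq (p := 2) (K := K)
    norm_num at h1 h2 ⊢
    rw [h1, h2]
  · have : Even (p - 1) := by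
      obtain ⟨k, rfl⟩ := h
      exact ⟨k, by omega⟩
    simp [this.neg_one_pow]

theorem norm_add_logTerm_le [IsCyclotomicExtension {p} ℚ_[p] K] {ζ : K}
    (hζ : IsPrimitiveRoot ζ p) {x : K} (hx : ‖x‖ < 1) :
    ‖x + logTerm x (p - 1)‖ ≤ ‖ζ - 1‖ ^ 2 := by
  have : IsUltrametricDist K := IsUltrametricDist.of_normedAlgebra ℚ_[p]
  have hE := (norm_sub_one_pow_add_prime_le (p := p) hζ).2
  have hπ0 : ζ - 1 ≠ 0 := sub_ne_zero.mpr (hζ.ne_one hp.out.one_lt)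
  have hr0 : 0 < ‖ζ - 1‖ := norm_pos_iff.2 hπ0
  have hpR : (0 : ℝ) < p := by exact_mod_cast hp.out.pos
  have hpn := norm_prime_eq (p := p) (K := K)
  have hp0 : (p : K) ≠ 0 := by
    rw [← norm_ne_zero_iff, hpn]
    positivity
  set π := ζ - 1 with hπ
  obtain ⟨a, rfl⟩ : ∃ a, x = π * a := ⟨x / π, by field_simp⟩
  have ha : ‖a‖ ≤ 1 := by
    have h := norm_le_of_norm_lt_one hζ hx
    rw [norm_mul] at h
    exact (mul_le_iff_le_one_right hr0).1 h
  set s : K := (-1) ^ (p - 1) with hs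
  set u : K := π ^ (p - 1) / p with hu
  have hu1 : ‖u + 1‖ ≤ ‖π‖ := by
    rw [hu, div_add_one hp0, norm_div, hpn, div_le_iff₀ (by positivity), mul_comm]
    exact hE
  have hs1 : ‖s‖ = 1 := by simp [hs]
  have hap : ‖a ^ p‖ ≤ 1 := by
    rw [norm_pow]
    exact pow_le_one₀ (norm_nonneg _) ha
  -- Each summand in the bracket is divisible by π: by Frobenius on 𝔽_p, by u ≡ -1, and by the sign
  -- estimate.
  have heq : π * a + logTerm (π * a) (p - 1) =
      π * (-(a ^ p - a) + (a ^ p * s * (u + 1) + a ^ p * (1 - s))) := by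
    have hpp : p - 1 + 1 = p := Nat.sub_add_cancel hp.out.one_le
    have : (π * a) ^ p = π * π ^ (p - 1) * a ^ p := by rw [mul_pow, ← pow_succ', hpp]
    rw [logTerm, hpp, this, ← hs, hu]
    field_simp
    ring
  rw [heq, norm_mul, sq]
  refine mul_le_mul_of_nonneg_left ?_ hr0.le
  refine (IsUltrametricDist.norm_add_le_max _ _).trans (max_le ?_ ?_)
  · rw [norm_neg]
    exact norm_pow_sub_self_le hζ ha
  refine (IsUltrametricDist.norm_add_le_max _ _).trans (max_le ?_ ?_)
  · rw [norm_mul, norm_mul, hs1, mul_one]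
    exact (mul_le_of_le_one_left (norm_nonneg _) hap).trans hu1
  · rw [norm_mul]
    exact (mul_le_of_le_one_left (norm_nonneg _) hap).trans (norm_one_sub_neg_one_pow_le hζ)

theorem norm_logTerm_le [IsCyclotomicExtension {p} ℚ_[p] K] {ζ : K}
    (hζ : IsPrimitiveRoot ζ p) {x : K} (hx : ‖x‖ < 1) {n : ℕ} (h0 : n ≠ 0) (h1 : n ≠ p - 1) :
    ‖logTerm x n‖ ≤ ‖ζ - 1‖ ^ 2 := by
  have hlt := (norm_sub_one_pow_add_prime_le (p := p) hζ).1
  have hr0 : 0 < ‖ζ - 1‖ := norm_pos_iff.2 (sub_ne_zero.mpr (hζ.ne_one hp.out.one_lt))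
  have hle := norm_le_of_norm_lt_one hζ hx
  have := sub_one_mul_padicValNat_lt (p := p) h0 (by omega)
  rw [norm_logTerm, norm_succ_eq_pow hζ, div_le_iff₀ (by positivity), ← pow_add]
  calc ‖x‖ ^ (n + 1) ≤ ‖ζ - 1‖ ^ (n + 1) := by gcongr
    _ ≤ _ := pow_le_pow_of_le_one hr0.le hlt.le (by omega)

theorem norm_padicLog_le [CompleteSpace K] [IsCyclotomicExtension {p} ℚ_[p] K] {ζ : K}
    (hζ : IsPrimitiveRoot ζ p) {x : K} (hx : ‖x‖ < 1) : ‖padicLog (1 + x)‖ ≤ ‖ζ - 1‖ ^ 2 := by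
  have : IsUltrametricDist K := IsUltrametricDist.of_normedAlgebra ℚ_[p]
  have hs := summable_logTerm p hx
  have hp2 := hp.out.two_le
  rw [padicLog, add_sub_cancel_left, ← hs.sum_add_tsum_compl (s := {0, p - 1}),
    Finset.sum_pair (by omega)]
  refine (IsUltrametricDist.norm_add_le_max _ _).trans (max_le ?_ ?_)
  · simpa [logTerm] using norm_add_logTerm_le hζ hx
  · refine IsUltrametricDist.norm_tsum_le_of_forall_le_of_nonneg (by positivity) fun n => ?_
    have hn := n.2
    simp only [Finset.coe_insert, Finset.coe_singleton, Set.mem_compl_iff, Set.mem_insert_iff,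
      Set.mem_singleton_iff, not_or] at hn
    exact norm_logTerm_le hζ hx hn.1 hn.2

end Logarithm

/-! ### Powers of the maximal ideal: index and pro-p structure. -/

section MaximalIdeal

open Filter Topology

variable {p : ℕ} [hp : Fact p.Prime] {K : Type*} [NormedField K] [NormedAlgebra ℚ_[p] K]

theorem mem_maxIdeal_iff (x : ringOfIntegers p K) : x ∈ maxIdeal p K ↔ ‖(x : K)‖ < 1 := by
  have hx1 := (mem_ringOfIntegers p K (x : K)).1 x.2
  rw [maxIdeal, IsLocalRing.mem_maximalIdeal, mem_nonunits_iff, ← not_le, not_iff_not]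
  constructor
  · rintro ⟨u, rfl⟩
    have h1 : ‖((u : ringOfIntegers p K) : K)‖ * ‖((↑u⁻¹ : ringOfIntegers p K) : K)‖ = 1 := by
      rw [← norm_mul, ← MulMemClass.coe_mul, Units.mul_inv, OneMemClass.coe_one, norm_one]
    rw [← h1]
    exact mul_le_of_le_one_right (norm_nonneg _) ((mem_ringOfIntegers p K _).1 (Subtype.prop _))
  · intro h
    have hx0 : (x : K) ≠ 0 := by
      rw [← norm_pos_iff]
      linarith
    have hinv : (x : K)⁻¹ ∈ ringOfIntegers p K := by
      rw [mem_ringOfIntegers, norm_inv]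
      exact inv_le_one_of_one_le₀ h
    exact IsUnit.of_mul_eq_one ⟨_, hinv⟩ (Subtype.ext (mul_inv_cancel₀ hx0))

theorem mem_principalUnits_iff (u : K) : u ∈ principalUnits p K ↔ ‖u - 1‖ < 1 := by
  constructor
  · rintro ⟨x, hx, rfl⟩
    rw [add_sub_cancel_left]
    exact (mem_maxIdeal_iff x).1 hx
  · intro h
    exact ⟨⟨u - 1, (mem_ringOfIntegers p K _).2 h.le⟩, (mem_maxIdeal_iff _).2 h, by simp⟩

theorem mem_maxIdeal_pow_iff [IsCyclotomicExtension {p} ℚ_[p] K] {ζ : K}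
    (hζ : IsPrimitiveRoot ζ p) (k : ℕ) (x : ringOfIntegers p K) :
    x ∈ maxIdeal p K ^ k ↔ ‖(x : K)‖ ≤ ‖ζ - 1‖ ^ k := by
  have hlt := (norm_sub_one_pow_add_prime_le (p := p) hζ).1
  have hπ0 : ζ - 1 ≠ 0 := sub_ne_zero.mpr (hζ.ne_one hp.out.one_lt)
  have hr0 : 0 < ‖ζ - 1‖ := norm_pos_iff.2 hπ0
  have key : ∀ (m : ℕ) (y : ringOfIntegers p K), y ∈ Ideal.span
      {(⟨ζ - 1, (mem_ringOfIntegers p K _).2 hlt.le⟩ : ringOfIntegers p K) ^ m} ↔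
      ‖(y : K)‖ ≤ ‖ζ - 1‖ ^ m := fun m y => by
    rw [Ideal.mem_span_singleton]
    constructor
    · rintro ⟨c, rfl⟩
      rw [MulMemClass.coe_mul, SubmonoidClass.coe_pow, norm_mul, norm_pow]
      exact mul_le_of_le_one_right (by positivity) ((mem_ringOfIntegers p K _).1 c.2)
    · intro h
      refine ⟨⟨y / (ζ - 1) ^ m, ?_⟩, Subtype.ext ?_⟩
      · rw [mem_ringOfIntegers, norm_div, norm_pow]
        exact div_le_one_of_le₀ h (by positivity)
      · rw [MulMemClass.coe_mul, SubmonoidClass.coe_pow, mul_div_cancel₀ _ (pow_ne_zero m hπ0)]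
  have hspan : maxIdeal p K = Ideal.span
      {(⟨ζ - 1, (mem_ringOfIntegers p K _).2 hlt.le⟩ : ringOfIntegers p K)} := by
    ext y
    have h1 := key 1 y
    rw [pow_one, pow_one] at h1
    rw [h1, mem_maxIdeal_iff]
    exact ⟨norm_le_of_norm_lt_one hζ, fun h => h.trans_lt hlt⟩
  rw [hspan, Ideal.span_singleton_pow, key]

variable (p K) in
/-- The square of the maximal ideal, as an additive subgroup of the maximal ideal. -/
noncomputable def maxIdealSq : AddSubgroup (maxIdeal p K) :=
  (maxIdeal p K ^ 2).toAddSubgroup.comap (maxIdeal p K).subtype.toAddMonoidHom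

theorem mem_maxIdealSq_iff (y : maxIdeal p K) :
    y ∈ maxIdealSq p K ↔ (y : ringOfIntegers p K) ∈ maxIdeal p K ^ 2 :=
  Iff.rfl

theorem index_maxIdealSq [IsCyclotomicExtension {p} ℚ_[p] K] {ζ : K}
    (hζ : IsPrimitiveRoot ζ p) : (maxIdealSq p K).index = p := by
  have : IsUltrametricDist K := IsUltrametricDist.of_normedAlgebra ℚ_[p]
  have hlt := (norm_sub_one_pow_add_prime_le (p := p) hζ).1
  have hπ0 : ζ - 1 ≠ 0 := sub_ne_zero.mpr (hζ.ne_one hp.out.one_lt)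
  have hr0 : 0 < ‖ζ - 1‖ := norm_pos_iff.2 hπ0
  set π : maxIdeal p K := ⟨⟨ζ - 1, (mem_ringOfIntegers p K _).2 hlt.le⟩,
    (mem_maxIdeal_iff _).2 hlt⟩ with hπ
  have hcoe : ∀ n : ℕ, (((n • π : maxIdeal p K) : ringOfIntegers p K) : K) = n * (ζ - 1) :=
    fun n => by simp [hπ]
  have hcoe_neg_add : ∀ a b : maxIdeal p K, (((-a + b : maxIdeal p K) : ringOfIntegers p K) : K) =
      -((a : ringOfIntegers p K) : K) + ((b : ringOfIntegers p K) : K) := fun _ _ => rfl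
  -- The multiples nπ with 0 ≤ n < p represent 𝔪/𝔪².
  have hbij : Function.Bijective
      (fun n : Fin p => (((n : ℕ) • π : maxIdeal p K) : maxIdeal p K ⧸ maxIdealSq p K)) := by
    constructor
    · intro m n hmn
      rw [QuotientAddGroup.eq, mem_maxIdealSq_iff, mem_maxIdeal_pow_iff hζ] at hmn
      have h1 : ‖(((-((m : ℕ) • π) + (n : ℕ) • π : maxIdeal p K) : ringOfIntegers p K) : K)‖ =
          ‖(((n : ℤ) - (m : ℤ) : ℤ) : K)‖ * ‖ζ - 1‖ := by
        rw [← norm_mul]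
        congr 1
        rw [hcoe_neg_add, hcoe, hcoe]
        push_cast
        ring
      rw [h1, sq] at hmn
      have h2 : ‖(((n : ℤ) - (m : ℤ) : ℤ) : K)‖ < 1 :=
        (le_of_mul_le_mul_right hmn hr0).trans_lt hlt
      rw [← map_intCast (algebraMap ℚ_[p] K), norm_algebraMap', Padic.norm_intCast_lt_one_iff] at h2
      have h3 := Int.eq_zero_of_abs_lt_dvd h2 (by rw [abs_lt]; omega)
      exact Fin.ext (by omega)
    · intro q
      obtain ⟨y, rfl⟩ := QuotientAddGroup.mk_surjective q
      have hy := norm_le_of_norm_lt_one hζ ((mem_maxIdeal_iff _).1 y.2)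
      obtain ⟨n, hn, hyn⟩ := exists_natCast_norm_sub_le hζ
        (x := ((y : ringOfIntegers p K) : K) / (ζ - 1))
        (by rw [norm_div]; exact div_le_one_of_le₀ hy hr0.le)
      refine ⟨⟨n, hn⟩, ?_⟩
      rw [QuotientAddGroup.eq, mem_maxIdealSq_iff, mem_maxIdeal_pow_iff hζ]
      have h1 : (((-(n • π) + y : maxIdeal p K) : ringOfIntegers p K) : K) =
          (((y : ringOfIntegers p K) : K) / (ζ - 1) - n) * (ζ - 1) := by
        rw [hcoe_neg_add, hcoe]
        field_simp
        ring
      change ‖(((-(n • π) + y : maxIdeal p K) : ringOfIntegers p K) : K)‖ ≤ _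
      rw [h1, norm_mul, sq]
      gcongr
  rw [AddSubgroup.index, ← Nat.card_congr (Equiv.ofBijective _ hbij), Nat.card_fin]

/-- Compactness makes G/U finite, and p^n g eventually enters U, so G/U is a p-group. -/
theorem exists_index_eq_pow_of_isOpen {G : Type*} [AddCommGroup G] [TopologicalSpace G]
    [IsTopologicalAddGroup G] [CompactSpace G]
    (htend : ∀ g : G, Tendsto (fun n : ℕ => p ^ n • g) atTop (𝓝 0)) (U : AddSubgroup G)
    (hU : IsOpen (U : Set G)) : ∃ k : ℕ, U.index = p ^ k := by
  have : Finite (G ⧸ U) := U.quotient_finite_of_isOpen hU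
  have : Finite (Multiplicative (G ⧸ U)) := this
  have hpg : IsPGroup p (Multiplicative (G ⧸ U)) := by
    intro q
    obtain ⟨g, hg⟩ := QuotientAddGroup.mk_surjective (Multiplicative.toAdd q)
    obtain ⟨n, hn⟩ := ((htend g).eventually (hU.mem_nhds U.zero_mem)).exists
    refine ⟨n, ?_⟩
    apply Multiplicative.toAdd.injective
    rw [toAdd_pow, ← hg, toAdd_one, ← QuotientAddGroup.mk_nsmul, QuotientAddGroup.eq_zero_iff]
    exact hn
  have hcard := IsPGroup.iff_card.1 hpg
  exact hcard

theorem isEmbedding_coe_maxIdealSq : IsEmbedding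
    (fun y : maxIdealSq p K => (((y : maxIdeal p K) : ringOfIntegers p K) : K)) :=
  IsEmbedding.subtypeVal.comp (IsEmbedding.subtypeVal.comp IsEmbedding.subtypeVal)

theorem range_coe_maxIdealSq [IsCyclotomicExtension {p} ℚ_[p] K] {ζ : K}
    (hζ : IsPrimitiveRoot ζ p) :
    Set.range (fun y : maxIdealSq p K => (((y : maxIdeal p K) : ringOfIntegers p K) : K)) =
      Metric.closedBall 0 (‖ζ - 1‖ ^ 2) := by
  have hlt := (norm_sub_one_pow_add_prime_le (p := p) hζ).1
  ext x
  rw [mem_closedBall_zero_iff]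
  constructor
  · rintro ⟨y, rfl⟩
    exact (mem_maxIdeal_pow_iff hζ 2 _).1 y.2
  · intro h
    have h1 : ‖x‖ < 1 := h.trans_lt (pow_lt_one₀ (norm_nonneg _) hlt two_ne_zero)
    exact ⟨⟨⟨⟨x, (mem_ringOfIntegers p K _).2 h1.le⟩, (mem_maxIdeal_iff _).2 h1⟩,
      (mem_maxIdeal_pow_iff hζ 2 _).2 h⟩, rfl⟩

theorem isProPAddGroup_maxIdealSq [IsCyclotomicExtension {p} ℚ_[p] K] {ζ : K}
    (hζ : IsPrimitiveRoot ζ p) : IsProPAddGroup p (maxIdealSq p K) := by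
  have : IsUltrametricDist K := IsUltrametricDist.of_normedAlgebra ℚ_[p]
  have : FiniteDimensional ℚ_[p] K := (hζ.powerBasis ℚ_[p]).finite
  have : ProperSpace K := FiniteDimensional.proper ℚ_[p] K
  have hemb := isEmbedding_coe_maxIdealSq (p := p) (K := K)
  have hgroup : IsTopologicalAddGroup (maxIdealSq p K) := inferInstance
  have hcompact : CompactSpace (maxIdealSq p K) := by
    rw [← isCompact_univ_iff, hemb.isCompact_iff, Set.image_univ, range_coe_maxIdealSq hζ]
    exact isCompact_closedBall _ _
  refine ⟨hgroup, hcompact, inferInstance, ?_, fun U _ hU => ?_⟩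
  · have : TotallyDisconnectedSpace K := inferInstance
    infer_instance
  · refine exists_index_eq_pow_of_isOpen (fun g => ?_) U hU
    rw [hemb.tendsto_nhds_iff]
    have h1 : Tendsto (fun n : ℕ => (p : K) ^ n * (((g : maxIdeal p K) : ringOfIntegers p K) : K))
        atTop (𝓝 (0 * (((g : maxIdeal p K) : ringOfIntegers p K) : K))) :=
      (tendsto_pow_atTop_nhds_zero_of_norm_lt_one (by
        rw [norm_prime_eq (p := p)]; exact prime_inv_lt_one)).mul_const _
    rw [zero_mul] at h1
    convert h1 using 2 with n
    · simp
    · rfl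

end MaximalIdeal

theorem theorem3p1 (p : ℕ) [Fact p.Prime] (K : Type*) [NormedField K] [NormedAlgebra ℚ_[p] K]
    [IsCyclotomicExtension {p} ℚ_[p] K] :
    (∀ u ∈ principalUnits p K, Summable (logTerm (u - 1))) ∧
      ∃ L : AddSubgroup (maxIdeal p K),
        (fun y : maxIdeal p K => ((y : ringOfIntegers p K) : K)) '' (L : Set (maxIdeal p K)) =
            padicLog '' principalUnits p K ∧
          (∀ y : maxIdeal p K, y ∈ L ↔ (y : ringOfIntegers p K) ∈ maxIdeal p K ^ 2) ∧
          IsProPAddGroup p L ∧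
          L.index = p := by
  have hζ := IsCyclotomicExtension.zeta_spec p ℚ_[p] K
  have : FiniteDimensional ℚ_[p] K := (hζ.powerBasis ℚ_[p]).finite
  have : CompleteSpace K := FiniteDimensional.complete ℚ_[p] K
  refine ⟨fun u hu => summable_logTerm p ((mem_principalUnits_iff u).1 hu),
    maxIdealSq p K, ?_, mem_maxIdealSq_iff, isProPAddGroup_maxIdealSq hζ, index_maxIdealSq hζ⟩
  have himage := range_coe_maxIdealSq (K := K) hζ
  rw [← Function.comp_def (fun y : maxIdeal p K => ((y : ringOfIntegers p K) : K)) Subtype.val,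
    Set.range_comp, Subtype.range_coe_subtype] at himage
  refine himage.trans (Set.ext fun z => ?_)
  rw [mem_closedBall_zero_iff]
  constructor
  · intro hz
    obtain ⟨x, hx, hxz⟩ := exists_padicLog_eq hζ hz
    refine ⟨1 + x, (mem_principalUnits_iff _).2 ?_, hxz⟩
    rw [add_sub_cancel_left]
    exact hx.trans_lt (pow_lt_one₀ (norm_nonneg _)
      (norm_sub_one_pow_add_prime_le (p := p) hζ).1 two_ne_zero)
  · rintro ⟨u, hu, rfl⟩
    rw [← add_sub_cancel 1 u]
    exact norm_padicLog_le hζ ((mem_principalUnits_iff u).1 hu)
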